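/- Let $f:[0,\infty)\to[0,\infty)$ be continuous with $f(0)=0$, and let $K>0$ be a locally unstable equilibrium, $f(K)=K$, with $f(x)>x$ for $x\in(0,K)$ and $0<f(x)<x$ for $x\in(K,\infty)$. Suppose that $f$ is three times differentiable on $(0,\infty)$ and differentiable from the right at $0$ with $f'(0)>1$, that $f$ is unimodal with a unique critical point $c\in(0,K)$ (strictly increasing on $[0,c]$, strictly decreasing on $[c,\infty)$), that $f''(x)<0$ for all $x\in(0,c)$, and that the Schwarzian derivative $$(Sf)(x)=\frac{f'''(x)}{f'(x)}-\frac32\left(\frac{f''(x)}{f'(x)}\right)^2$$ is negative for all $x\in(0,\infty)\setminus\{c\}$. Let $(\xi_n)_{n\ge1}$ be independent identically distributed random variables on a probability space, with $|\xi_n|\le1$ and $\mathbb P\{\xi_n\in(1-\varepsilon,1]\}>0$ for every $\varepsilon>0$; let $\xi$ denote a random variable with their common distribution. Put $$L_0=-f'(K),\qquad \alpha_0=\frac{L_0-1}{L_0+1},$$ and let $\alpha\in(0,\alpha_0)$ and $\ell\in\left(\alpha_0-\alpha,\ \min\{\alpha,1-\alpha\}\right)$. Assume that either $$\alpha+\ell<\frac{L_0}{L_0+1}\quad\text{and}\quad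 \mathbb E\ln\left[(1-\alpha-\ell\xi)L_0-\alpha-\ell\xi\right]<0,$$ or $$\mathbb E\max\left\{\ln\left[(1-\alpha-\ell\xi)L_0\right],\ \ln[\alpha+\ell\xi]\right\}<0.$$ Then for every (nonrandom) $x_0>0$ the solution of $$x_{n+1}=(1-\alpha-\ell\xi_{n+1})f(x_n)+(\alpha+\ell\xi_{n+1})x_n,\qquad n\ge0,$$ satisfies $\lim_{n\to\infty}x_n=K$ almost surely. -/

import Mathlib

open Set Filter Topology MeasureTheory ProbabilityTheory

/-- Lyapunov instability of the equilibrium `K` of the map `f : [0, ∞) → [0, ∞)`. -/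
def LocallyUnstable (f : ℝ → ℝ) (K : ℝ) : Prop :=
  ¬ ∀ ε > 0, ∃ δ > 0, ∀ x ≥ 0, |x - K| < δ → ∀ n : ℕ, |f^[n] x - K| < ε

/-- The basic assumption on the map `f : [0, ∞) → [0, ∞)` with unique positive equilibrium `K`.
Maps on the half-line are written as functions on `ℝ`; only their values on `[0, ∞)` matter. -/
structure PopulationMap (f : ℝ → ℝ) (K : ℝ) : Prop where
  mapsTo : MapsTo f (Ici 0) (Ici 0)
  continuousOn : ContinuousOn f (Ici 0)
  map_zero : f 0 = 0
  pos : 0 < K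
  map_eq : f K = K
  lt_map : ∀ x ∈ Ioo 0 K, x < f x
  map_pos : ∀ x ∈ Ioi K, 0 < f x
  map_lt : ∀ x ∈ Ioi K, f x < x
  unstable : LocallyUnstable f K

/-- The Schwarzian derivative `f''' / f' - (3/2) (f'' / f')²`. -/
noncomputable def schwarzian (f : ℝ → ℝ) (x : ℝ) : ℝ :=
  iteratedDeriv 3 f x / deriv f x - 3 / 2 * (iteratedDeriv 2 f x / deriv f x) ^ 2

/-- Unimodal maps, three times differentiable, with maximum at the unique critical point
`c ∈ (0, K)`, `f'(0) > 1` (one-sided derivative), concave to the left of `c`, and with negative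
Schwarzian derivative away from `c`. -/
structure SingerMap (f : ℝ → ℝ) (K : ℝ) : Prop extends PopulationMap f K where
  differentiableOn : ∀ k < 3, DifferentiableOn ℝ (iteratedDeriv k f) (Ioi 0)
  differentiable_zero : DifferentiableWithinAt ℝ f (Ici 0) 0
  one_lt_deriv_zero : 1 < derivWithin f (Ici 0) 0
  unimodal : ∃ c ∈ Ioo 0 K,
    StrictMonoOn f (Icc 0 c) ∧ StrictAntiOn f (Ici c) ∧
    (∀ x > 0, deriv f x = 0 ↔ x = c) ∧
    (∀ x ∈ Ioo 0 c, iteratedDeriv 2 f x < 0) ∧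
    (∀ x > 0, x ≠ c → schwarzian f x < 0)

/-- The noise: i.i.d. random variables with values in `[-1, 1]` that charge every
left neighbourhood of `1`. Here `ξ n` stands for `ξ_{n+1}`, so the sequence is
`ξ_1, ξ_2, …`. -/
structure BoundedNoise {Ω : Type*} [MeasurableSpace Ω] (P : Measure Ω) (ξ : ℕ → Ω → ℝ) :
    Prop where
  measurable : ∀ n, Measurable (ξ n)
  indep : iIndepFun ξ P
  identDistrib : ∀ n, IdentDistrib (ξ n) (ξ 0) P P
  bounded : ∀ n, ∀ᵐ ω ∂P, |ξ n ω| ≤ 1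
  charges_one : ∀ ε > 0, ∀ n, 0 < P {ω | ξ n ω ∈ Ioc (1 - ε) 1}

/-- `x` solves `x_{n+1} = (1 - α - ℓ ξ_{n+1}) f(x_n) + (α + ℓ ξ_{n+1}) x_n` with the
nonrandom initial value `x₀` (recall that `ξ n` stands for `ξ_{n+1}`). -/
def IsPBCSolution {Ω : Type*} (f : ℝ → ℝ) (α ℓ : ℝ) (ξ : ℕ → Ω → ℝ) (x₀ : ℝ)
    (x : ℕ → Ω → ℝ) : Prop :=
  (∀ ω, x 0 ω = x₀) ∧
    ∀ n ω, x (n + 1) ω = (1 - α - ℓ * ξ n ω) * f (x n ω) + (α + ℓ * ξ n ω) * x n ω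

/-!
A negative Schwarzian derivative makes `(-f')^(-1/2)` convex beyond the critical point. Comparing
`f` with the Möbius maps for which this function is affine gives an inequality between the
distances of two points on either side of `K` and those of their images. It follows that, once the
intensity `b` of the control satisfies `L₀ (1 - b) < 1 + b`, the controlled map cannot exchange two
such points. Hence, if the control may be chosen at every step in an interval of such intensities,
all orbits in a compact invariant interval are attracted to `K` uniformly in the choice of
controls.

Almost surely the noise has a block of values near `1`, as long as desired, after which the partial
sums of the logarithms of the local multipliers at `K` stay below a fixed constant: for a fixed
block length this event has positive probability by independence and the strong law, so it recurs
by the zero-one law. The block brings the orbit close to `K`, and from there the multipliers, whose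
logarithm has negative mean, contract it to `K`.
-/

theorem hasDerivAt_rpow_neg_half {g : ℝ → ℝ} {g' x : ℝ} (hg : HasDerivAt g g' x) (hx : 0 < g x) :
    HasDerivAt (fun t => g t ^ (-1 / 2 : ℝ)) (-1 / 2 * g' * g x ^ (-3 / 2 : ℝ)) x := by
  refine (hg.rpow_const (p := -1 / 2) (Or.inl hx.ne')).congr_deriv ?_
  rw [show (-1 / 2 - 1 : ℝ) = -3 / 2 by norm_num]
  ring

theorem hasDerivAt_mul_rpow_neg_three_halves {g g' : ℝ → ℝ} {g'' x : ℝ}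
    (hg : HasDerivAt g (g' x) x) (hg' : HasDerivAt g' g'' x) (hx : 0 < g x) :
    HasDerivAt (fun t => -1 / 2 * g' t * g t ^ (-3 / 2 : ℝ))
      (-1 / 2 * g x ^ (-1 / 2 : ℝ) * (g'' / g x - 3 / 2 * (g' x / g x) ^ 2)) x := by
  refine ((hg'.const_mul (-1 / 2)).mul
    (hg.rpow_const (p := -3 / 2) (Or.inl hx.ne'))).congr_deriv ?_
  have h₁ : g x ^ (-1 / 2 : ℝ) = g x ^ (-5 / 2 : ℝ) * g x ^ 2 := by
    rw [← Real.rpow_natCast, ← Real.rpow_add hx]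
    norm_num
  have h₃ : g x ^ (-3 / 2 : ℝ) = g x ^ (-5 / 2 : ℝ) * g x := by
    rw [← Real.rpow_add_one hx.ne']
    norm_num
  rw [show (-3 / 2 - 1 : ℝ) = -5 / 2 by norm_num, h₁, h₃]
  field_simp
  ring

theorem convexOn_neg_deriv_rpow_of_schwarzian_nonpos {f : ℝ → ℝ} {s : Set ℝ} (hs : IsOpen s)
    (hconv : Convex ℝ s) (hd₁ : DifferentiableOn ℝ (deriv f) s)
    (hd₂ : DifferentiableOn ℝ (iteratedDeriv 2 f) s) (hneg : ∀ x ∈ s, deriv f x < 0)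
    (hS : ∀ x ∈ s, schwarzian f x ≤ 0) :
    ConvexOn ℝ s (fun x => (-deriv f x) ^ (-1 / 2 : ℝ)) := by
  have hderiv₁ : ∀ x ∈ s, HasDerivAt (fun t => -deriv f t) (-iteratedDeriv 2 f x) x := by
    intro x hx
    rw [iteratedDeriv_succ, iteratedDeriv_one]
    exact (hd₁.differentiableAt (hs.mem_nhds hx)).hasDerivAt.neg
  have hderiv₂ : ∀ x ∈ s, HasDerivAt (fun t => -iteratedDeriv 2 f t) (-iteratedDeriv 3 f x) x := by
    intro x hx
    rw [iteratedDeriv_succ (n := 2)]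
    exact (hd₂.differentiableAt (hs.mem_nhds hx)).hasDerivAt.neg
  have hpos : ∀ x ∈ s, 0 < -deriv f x := fun x hx => neg_pos.2 (hneg x hx)
  refine convexOn_of_hasDerivWithinAt2_nonneg hconv (fun x hx =>
    (hasDerivAt_rpow_neg_half (hderiv₁ x hx) (hpos x hx)).continuousAt.continuousWithinAt)
    (fun x hx => (hasDerivAt_rpow_neg_half (hderiv₁ x (interior_subset hx))
      (hpos x (interior_subset hx))).hasDerivWithinAt)
    (fun x hx => (hasDerivAt_mul_rpow_neg_three_halves (hderiv₁ x (interior_subset hx))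
      (hderiv₂ x (interior_subset hx)) (hpos x (interior_subset hx))).hasDerivWithinAt)
    fun x hx => ?_
  have hx' := interior_subset hx
  rw [neg_div_neg_eq, neg_div_neg_eq]
  exact mul_nonneg_of_nonpos_of_nonpos
    (mul_nonpos_of_nonpos_of_nonneg (by norm_num) (Real.rpow_nonneg (hpos x hx').le _)) (hS x hx')

theorem exists_supporting_line {φ : ℝ → ℝ} {s : Set ℝ} {a : ℝ} (hφ : ConvexOn ℝ s φ)
    (ha : a ∈ interior s) : ∃ m, ∀ t ∈ s, φ a + m * (t - a) ≤ φ t := by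
  refine ⟨derivWithin φ (Ioi a) a, fun t ht => ?_⟩
  rcases lt_trichotomy t a with hta | rfl | hta
  · have h := (hφ.slope_le_leftDeriv_of_mem_interior ht ha hta).trans
      (hφ.leftDeriv_le_rightDeriv_of_mem_interior ha)
    rw [slope_def_field, div_le_iff₀ (sub_pos.2 hta)] at h
    linarith
  · simp
  · have h := hφ.rightDeriv_le_slope_of_mem_interior ha ht hta
    rw [slope_def_field, le_div_iff₀ (sub_pos.2 hta)] at h
    linarith

theorem convex_setOf_affine_pos (p m a : ℝ) : Convex ℝ {t : ℝ | 0 < p + m * (t - a)} := by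
  have h : {t : ℝ | 0 < p + m * (t - a)} = {t | m * a - p < m * t} := by
    ext t
    rw [mem_ofPred_eq, mem_ofPred_eq, mul_sub]
    constructor <;> intro ht <;> linarith
  exact h ▸ convex_halfSpace_gt (IsLinearMap.isLinearMap_smul m) _

theorem monotoneOn_add_moebius {f : ℝ → ℝ} {s : Set ℝ} {a p m : ℝ} (hs : Convex ℝ s)
    (hf : ContinuousOn f s) (hd : ∀ t ∈ interior s, DifferentiableAt ℝ f t) (hp : p ≠ 0)
    (hpos : ∀ t ∈ s, 0 < p + m * (t - a))
    (hle : ∀ t ∈ interior s, -deriv f t ≤ ((p + m * (t - a)) ^ 2)⁻¹) :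
    MonotoneOn (fun t => f t + (t - a) / (p * (p + m * (t - a)))) s := by
  have hmoebius : ∀ t ∈ s, HasDerivAt (fun t => (t - a) / (p * (p + m * (t - a))))
      ((p + m * (t - a)) ^ 2)⁻¹ t := by
    intro t ht
    have hne := (hpos t ht).ne'
    have hsub : HasDerivAt (fun t => t - a) 1 t := (hasDerivAt_id t).sub_const a
    refine (hsub.div (((hsub.const_mul m).const_add p).const_mul p)
      (mul_ne_zero hp hne)).congr_deriv ?_
    field_simp
    ring
  refine monotoneOn_of_hasDerivWithinAt_nonneg hs
    (hf.add fun t ht => (hmoebius t ht).continuousAt.continuousWithinAt)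
    (fun t ht => ((hd t ht).hasDerivAt.add (hmoebius t (interior_subset ht))).hasDerivWithinAt)
    fun t ht => ?_
  linarith [hle t ht]

theorem sq_rpow_neg_half {x : ℝ} (hx : 0 ≤ x) : (x ^ (-1 / 2 : ℝ)) ^ 2 = x⁻¹ := by
  rw [← Real.rpow_natCast, ← Real.rpow_mul hx, ← Real.rpow_neg_one]
  norm_num

/-- Equality holds for the Möbius maps, for which `(-f')^(-1/2)` is affine. -/
theorem exists_mul_affine_le_div_sub {f : ℝ → ℝ} {s : Set ℝ} {a : ℝ} (hs : Convex ℝ s)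
    (hf : ContinuousOn f s) (hneg : ∀ t ∈ interior s, deriv f t < 0)
    (hconv : ConvexOn ℝ (interior s) fun t => (-deriv f t) ^ (-1 / 2 : ℝ))
    (ha : a ∈ interior s) :
    ∃ m, ∀ t ∈ s, t ≠ a → (-deriv f a) ^ (-1 / 2 : ℝ) *
      ((-deriv f a) ^ (-1 / 2 : ℝ) + m * (t - a)) ≤ (t - a) / (f a - f t) := by
  obtain ⟨m, hm⟩ := exists_supporting_line hconv (by rwa [interior_interior])
  have hanti : StrictAntiOn f s := strictAntiOn_of_deriv_neg hs hf hneg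
  have has : a ∈ s := interior_subset ha
  set p := (-deriv f a) ^ (-1 / 2 : ℝ)
  have hp : 0 < p := Real.rpow_pos_of_pos (neg_pos.2 (hneg a ha)) _
  have hmono : MonotoneOn (fun t => f t + (t - a) / (p * (p + m * (t - a))))
      (s ∩ {t | 0 < p + m * (t - a)}) := by
    refine monotoneOn_add_moebius (hs.inter (convex_setOf_affine_pos p m a))
      (hf.mono inter_subset_left) (fun t ht => ?_) hp.ne' (fun t ht => ht.2) fun t ht => ?_
    · exact differentiableAt_of_deriv_ne_zero (hneg t (interior_mono inter_subset_left ht)).ne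
    · have hts := interior_mono inter_subset_left ht
      have hl : 0 < p + m * (t - a) := (interior_subset ht).2
      rw [← inv_inv (-deriv f t), ← sq_rpow_neg_half (neg_pos.2 (hneg t hts)).le]
      gcongr
      exact hm t hts
  refine ⟨m, fun t ht hta => ?_⟩
  rcases le_or_gt (p + m * (t - a)) 0 with hl | hl
  · refine (mul_nonpos_of_nonneg_of_nonpos hp.le hl).trans ?_
    rcases hta.lt_or_gt with hlt | hlt
    · exact div_nonneg_of_nonpos (sub_nonpos.2 hlt.le) (sub_nonpos.2 (hanti ht has hlt).le)
    · exact div_nonneg (sub_nonneg.2 hlt.le) (sub_nonneg.2 (hanti has ht hlt).le)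
  have htD : t ∈ s ∩ {t | 0 < p + m * (t - a)} := ⟨ht, hl⟩
  have haD : a ∈ s ∩ {t | 0 < p + m * (t - a)} := ⟨has, by simpa using hp⟩
  have hpl : 0 < p * (p + m * (t - a)) := mul_pos hp hl
  rcases hta.lt_or_gt with hlt | hlt
  · have h := hmono htD haD hlt.le
    simp only [sub_self, zero_div, add_zero] at h
    rw [← neg_div_neg_eq, le_div_iff₀ (by linarith [hanti ht has hlt]), mul_comm,
      ← le_div_iff₀ hpl, neg_div]
    linarith
  · have h := hmono haD htD hlt.le
    simp only [sub_self, zero_div, add_zero] at h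
    rw [le_div_iff₀ (by linarith [hanti has ht hlt]), mul_comm, ← le_div_iff₀ hpl]
    linarith

theorem inv_neg_deriv_mul_le_inv_add_inv {f : ℝ → ℝ} {s : Set ℝ} {a x y : ℝ} (hs : Convex ℝ s)
    (hf : ContinuousOn f s) (hneg : ∀ t ∈ interior s, deriv f t < 0)
    (hconv : ConvexOn ℝ (interior s) fun t => (-deriv f t) ^ (-1 / 2 : ℝ))
    (ha : a ∈ interior s) (hx : x ∈ s) (hy : y ∈ s) (hxa : x < a) (hay : a < y) :
    (-deriv f a)⁻¹ * ((a - x)⁻¹ + (y - a)⁻¹) ≤ (f x - f a)⁻¹ + (f a - f y)⁻¹ := by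
  obtain ⟨m, hm⟩ := exists_mul_affine_le_div_sub hs hf hneg hconv ha
  rw [← sq_rpow_neg_half (neg_pos.2 (hneg a ha)).le]
  set p := (-deriv f a) ^ (-1 / 2 : ℝ)
  have hxa' : 0 < a - x := sub_pos.2 hxa
  have hay' : 0 < y - a := sub_pos.2 hay
  have hleft : p ^ 2 * (a - x)⁻¹ - p * m ≤ (f x - f a)⁻¹ := by
    have h := hm x hx hxa.ne
    rw [← neg_div_neg_eq, neg_sub, neg_sub, div_eq_mul_inv, ← div_le_iff₀' hxa'] at h
    refine le_of_eq_of_le ?_ h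
    field_simp
    ring
  have hright : p ^ 2 * (y - a)⁻¹ + p * m ≤ (f a - f y)⁻¹ := by
    have h := hm y hy hay.ne'
    rw [div_eq_mul_inv, ← div_le_iff₀' hay'] at h
    refine le_of_eq_of_le ?_ h
    field_simp
  linarith

/-- In terms of the distances `u`, `v` of two points to the equilibrium on either side of it, and
of the distances `p`, `q` of their images, the hypotheses say that the controlled images exchange
the two points, at least weakly. -/
theorem inv_add_inv_lt_of_exchange {b L u v p q : ℝ} (hb₀ : 0 ≤ b) (hb₁ : b < 1) (hL : 0 < L)
    (hbL : L * (1 - b) < 1 + b) (hu : 0 < u) (hv : 0 < v) (hp : v + b * u ≤ (1 - b) * p)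
    (hq : u + b * v ≤ (1 - b) * q) : p⁻¹ + q⁻¹ < L⁻¹ * (u⁻¹ + v⁻¹) := by
  have hb : 0 < 1 - b := sub_pos.2 hb₁
  have inv_le {r w : ℝ} (hw : 0 < w) (hr : w ≤ (1 - b) * r) : r⁻¹ ≤ (1 - b) / w := by
    rw [← inv_div]
    exact inv_anti₀ (by positivity) ((div_le_iff₀' hb).2 hr)
  calc p⁻¹ + q⁻¹ ≤ (1 - b) / (v + b * u) + (1 - b) / (u + b * v) :=
        add_le_add (inv_le (by positivity) hp) (inv_le (by positivity) hq)
    _ = (1 - b) * (1 + b) * (u + v) / ((v + b * u) * (u + b * v)) := by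
        field_simp
        ring
    _ ≤ (1 - b) * (1 + b) * (u + v) / (u * v * (1 + b) ^ 2) := by
        gcongr (1 - b) * (1 + b) * (u + v) / ?_
        nlinarith only [mul_nonneg hb₀ (sq_nonneg (u - v))]
    _ = (1 - b) / (1 + b) * (u⁻¹ + v⁻¹) := by
        field_simp
        ring
    _ < L⁻¹ * (u⁻¹ + v⁻¹) := by
        gcongr
        rwa [div_lt_iff₀ (by positivity), ← div_eq_inv_mul, lt_div_iff₀' hL]

/-- A generalization of `SingerMap` of lower smoothness: convexity of `(-f')^(-1/2)` beyond the
maximum point `c` replaces the negative Schwarzian derivative, and to the left of `c` the map is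
only required to be continuous and at most `f c`. -/
structure WeakSingerMap (f : ℝ → ℝ) (c K : ℝ) : Prop where
  continuousOn : ContinuousOn f (Ici 0)
  critical_nonneg : 0 ≤ c
  critical_lt : c < K
  map_eq : f K = K
  lt_map : ∀ x ∈ Ioo 0 K, x < f x
  map_nonneg : ∀ x > K, 0 ≤ f x
  le_map_critical : ∀ x ∈ Icc 0 c, f x ≤ f c
  deriv_neg : ∀ x > c, deriv f x < 0
  convexOn : ConvexOn ℝ (Ioi c) fun x => (-deriv f x) ^ (-1 / 2 : ℝ)

theorem SingerMap.exists_weakSingerMap {f : ℝ → ℝ} {K : ℝ} (hf : SingerMap f K) :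
    ∃ c, WeakSingerMap f c K := by
  obtain ⟨c, ⟨hc, hcK⟩, hmono, hanti, hcrit, -, hS⟩ := hf.unimodal
  have hneg : ∀ x > c, deriv f x < 0 := fun x hx => by
    have h : derivWithin f (Ici c) x ≤ 0 := hanti.antitoneOn.derivWithin_nonpos
    rw [derivWithin_of_mem_nhds (Ici_mem_nhds hx)] at h
    exact h.lt_of_ne fun h₀ => hx.ne' ((hcrit x (hc.trans hx)).1 h₀)
  have hdiff : ∀ k < 3, DifferentiableOn ℝ (iteratedDeriv k f) (Ioi c) := fun k hk =>
    (hf.differentiableOn k hk).mono (Ioi_subset_Ioi hc.le)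
  exact ⟨c, {
    continuousOn := hf.continuousOn
    critical_nonneg := hc.le
    critical_lt := hcK
    map_eq := hf.map_eq
    lt_map := hf.lt_map
    map_nonneg := fun x hx => (hf.map_pos x hx).le
    le_map_critical := fun x hx => hmono.monotoneOn hx (right_mem_Icc.2 hc.le) hx.2
    deriv_neg := hneg
    convexOn := convexOn_neg_deriv_rpow_of_schwarzian_nonpos isOpen_Ioi (convex_Ioi c)
      (iteratedDeriv_one (f := f) ▸ hdiff 1 (by norm_num)) (hdiff 2 (by norm_num)) hneg
      fun x hx => (hS x (hc.trans hx) hx.ne').le }⟩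

/-- The map `f` under prediction based control of intensity `b`. -/
def pbcMap (f : ℝ → ℝ) (b x : ℝ) : ℝ := (1 - b) * f x + b * x

section pbcMap

variable {f : ℝ → ℝ} {b b' x : ℝ}

theorem lt_pbcMap (hb : b < 1) (hx : x < f x) : x < pbcMap f b x := by
  have := mul_lt_mul_of_pos_left hx (sub_pos.2 hb)
  rw [pbcMap]
  linarith

theorem pbcMap_lt (hb : b < 1) (hx : f x < x) : pbcMap f b x < x := by
  have := mul_lt_mul_of_pos_left hx (sub_pos.2 hb)
  rw [pbcMap]
  linarith

theorem pbcMap_self (b : ℝ) (hx : f x = x) : pbcMap f b x = x := by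
  rw [pbcMap, hx]
  ring

theorem pbcMap_le_pbcMap_of_le_map (hx : x ≤ f x) (hb : b ≤ b') :
    pbcMap f b' x ≤ pbcMap f b x := by
  have := mul_le_mul_of_nonneg_left hx (sub_nonneg.2 hb)
  rw [pbcMap, pbcMap]
  linarith

theorem pbcMap_le_pbcMap_of_map_le (hx : f x ≤ x) (hb : b ≤ b') :
    pbcMap f b x ≤ pbcMap f b' x := by
  have := mul_le_mul_of_nonneg_left hx (sub_nonneg.2 hb)
  rw [pbcMap, pbcMap]
  linarith

theorem continuousOn_uncurry_pbcMap {s : Set ℝ} (hf : ContinuousOn f s) (u : Set ℝ) :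
    ContinuousOn (Function.uncurry (pbcMap f)) (u ×ˢ s) :=
  ((continuousOn_const.sub continuousOn_fst).mul
    (hf.comp continuousOn_snd fun _ h => h.2)).add (continuousOn_fst.mul continuousOn_snd)

theorem eventually_abs_pbcMap_sub_le {K ε : ℝ} (hd : DifferentiableAt ℝ f K) (hK : f K = K)
    (hε : 0 < ε) : ∀ᶠ x in 𝓝 K, ∀ b ∈ Icc (0 : ℝ) 1,
      |pbcMap f b x - K| ≤ (|b + (1 - b) * deriv f K| + ε) * |x - K| := by
  filter_upwards [hd.hasDerivAt.isLittleO.def hε] with x hx b hb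
  simp only [Real.norm_eq_abs, smul_eq_mul, hK] at hx
  have hb' : |1 - b| ≤ 1 := abs_le.2 ⟨by linarith [hb.2], by linarith [hb.1]⟩
  calc |pbcMap f b x - K|
      = |(b + (1 - b) * deriv f K) * (x - K) + (1 - b) * (f x - K - (x - K) * deriv f K)| := by
        rw [pbcMap]
        ring_nf
    _ ≤ |b + (1 - b) * deriv f K| * |x - K| + |1 - b| * |f x - K - (x - K) * deriv f K| := by
        rw [← abs_mul, ← abs_mul]
        exact abs_add_le _ _
    _ ≤ |b + (1 - b) * deriv f K| * |x - K| + 1 * (ε * |x - K|) := by gcongr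
    _ = (|b + (1 - b) * deriv f K| + ε) * |x - K| := by ring

end pbcMap

section ControlledDynamics

variable {U X : Type*} {F : U → X → X} {u : Set U} {s : Set X}

/-- The points to which the controls in `u` can steer `s` in `n` steps of the dynamics
`x ↦ F b x`, `b ∈ u`. -/
def reachableSet (F : U → X → X) (u : Set U) (s : Set X) (n : ℕ) : Set X := (image2 F u)^[n] s

/-- The points of `s` reachable from `s` in any number of steps; it is an attractor when
`s` is a compact absorbing set. -/
def attractor (F : U → X → X) (u : Set U) (s : Set X) : Set X := ⋂ n, reachableSet F u s n

theorem reachableSet_succ (n : ℕ) :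
    reachableSet F u s (n + 1) = image2 F u (reachableSet F u s n) :=
  Function.iterate_succ_apply' _ _ _

theorem antitone_reachableSet (hs : image2 F u s ⊆ s) : Antitone (reachableSet F u s) :=
  (show Monotone (image2 F u) from fun _ _ h => image2_subset_left h).antitone_iterate_of_map_le hs

theorem reachableSet_subset (hs : image2 F u s ⊆ s) (n : ℕ) : reachableSet F u s n ⊆ s :=
  antitone_reachableSet hs n.zero_le

theorem mem_reachableSet {z : ℕ → X} (h₀ : z 0 ∈ s) {n : ℕ}
    (h : ∀ i < n, ∃ b ∈ u, z (i + 1) = F b (z i)) : z n ∈ reachableSet F u s n := by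
  induction n with
  | zero => exact h₀
  | succ n ih =>
    obtain ⟨b, hb, hz⟩ := h n n.lt_succ_self
    rw [reachableSet_succ, hz]
    exact mem_image2_of_mem hb (ih fun i hi => h i (hi.trans n.lt_succ_self))

variable [TopologicalSpace U] [TopologicalSpace X]

theorem isCompact_reachableSet (hu : IsCompact u) (hsc : IsCompact s)
    (hF : ContinuousOn (Function.uncurry F) (u ×ˢ s)) (hs : image2 F u s ⊆ s) (n : ℕ) :
    IsCompact (reachableSet F u s n) := by
  induction n with
  | zero => exact hsc
  | succ n ih =>
    rw [reachableSet_succ, ← image_uncurry_prod]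
    exact (hu.prod ih).image_of_continuousOn
      (hF.mono (prod_mono_right (reachableSet_subset hs n)))

theorem isCompact_attractor [T2Space X] (hu : IsCompact u) (hsc : IsCompact s)
    (hF : ContinuousOn (Function.uncurry F) (u ×ˢ s)) (hs : image2 F u s ⊆ s) :
    IsCompact (attractor F u s) :=
  hsc.of_isClosed_subset (isClosed_iInter fun n => (isCompact_reachableSet hu hsc hF hs n).isClosed)
    (iInter_subset _ 0)

theorem attractor_subset_image2 [T2Space U] [T2Space X] (hu : IsCompact u) (hsc : IsCompact s)
    (hF : ContinuousOn (Function.uncurry F) (u ×ˢ s)) (hs : image2 F u s ⊆ s) :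
    attractor F u s ⊆ image2 F u (attractor F u s) := by
  intro y hy
  let preimages : ℕ → Set (U × X) := fun n =>
    (u ×ˢ reachableSet F u s n) ∩ Function.uncurry F ⁻¹' {y}
  have hcompact : ∀ n, IsCompact (u ×ˢ reachableSet F u s n) := fun n =>
    hu.prod (isCompact_reachableSet hu hsc hF hs n)
  have hclosed : ∀ n, IsClosed (preimages n) := fun n =>
    (hF.mono (prod_mono_right (reachableSet_subset hs n))).preimage_isClosed_of_isClosed
      (hcompact n).isClosed isClosed_singleton
  have hnonempty : ∀ n, (preimages n).Nonempty := fun n => by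
    have hy' := mem_iInter.1 hy (n + 1)
    rw [reachableSet_succ] at hy'
    obtain ⟨b, hb, x, hx, hxy⟩ := hy'
    exact ⟨(b, x), ⟨hb, hx⟩, hxy⟩
  obtain ⟨⟨b, x⟩, hbx⟩ := IsCompact.nonempty_iInter_of_sequence_nonempty_isCompact_isClosed
    preimages (fun n => inter_subset_inter_left _
      (prod_mono_right (antitone_reachableSet hs n.le_succ)))
    hnonempty ((hcompact 0).of_isClosed_subset (hclosed 0) inter_subset_left) hclosed
  rw [mem_iInter] at hbx
  exact ⟨b, (hbx 0).1.1, x, mem_iInter.2 fun n => (hbx n).1.2, (hbx 0).2⟩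

theorem exists_reachableSet_subset [T2Space X] (hu : IsCompact u) (hsc : IsCompact s)
    (hF : ContinuousOn (Function.uncurry F) (u ×ˢ s)) (hs : image2 F u s ⊆ s) {V : Set X}
    (hV : V ∈ 𝓝ˢ (attractor F u s)) : ∃ n, reachableSet F u s n ⊆ V :=
  exists_subset_nhds_of_isCompact (antitone_reachableSet hs).directed_ge
    (isCompact_reachableSet hu hsc hF hs) fun _ hx => mem_nhdsSet_iff_forall.1 hV _ hx

end ControlledDynamics

namespace WeakSingerMap

variable {f : ℝ → ℝ} {c K : ℝ}

theorem pos (hf : WeakSingerMap f c K) : 0 < K := hf.critical_nonneg.trans_lt hf.critical_lt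

theorem continuousOn_Icc (hf : WeakSingerMap f c K) {A B : ℝ} (hA : 0 ≤ A) :
    ContinuousOn f (Icc A B) :=
  hf.continuousOn.mono (Icc_subset_Ici_self.trans (Ici_subset_Ici.2 hA))

theorem strictAntiOn (hf : WeakSingerMap f c K) : StrictAntiOn f (Ici c) :=
  strictAntiOn_of_deriv_neg (convex_Ici c)
    (hf.continuousOn.mono (Ici_subset_Ici.2 hf.critical_nonneg)) <| by
      rw [interior_Ici]
      exact hf.deriv_neg

theorem map_lt (hf : WeakSingerMap f c K) {x : ℝ} (hx : K < x) : f x < x :=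
  calc f x < f K := hf.strictAntiOn hf.critical_lt.le (hf.critical_lt.trans hx).le hx
    _ = K := hf.map_eq
    _ < x := hx

theorem map_le_critical (hf : WeakSingerMap f c K) {x : ℝ} (hx : 0 ≤ x) : f x ≤ f c := by
  rcases le_total x c with hxc | hxc
  · exact hf.le_map_critical x ⟨hx, hxc⟩
  · exact hf.strictAntiOn.antitoneOn self_mem_Ici hxc hxc

theorem exists_invariant_Icc (hf : WeakSingerMap f c K) {β x₀ : ℝ} (hβ : 0 < β) (hx₀ : 0 < x₀) :
    ∃ A B, 0 < A ∧ x₀ ∈ Icc A B ∧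
      ∀ b ∈ Ico β 1, MapsTo (pbcMap f b) (Icc A B) (Icc A B) := by
  have hA : 0 < min x₀ (β * K) := lt_min hx₀ (mul_pos hβ hf.pos)
  refine ⟨min x₀ (β * K), max x₀ (f c), hA, ⟨min_le_left _ _, le_max_left _ _⟩, ?_⟩
  rintro b ⟨hβb, hb⟩ x ⟨hAx, hxB⟩
  have hx : 0 < x := hA.trans_le hAx
  have hb' : 0 ≤ 1 - b := sub_nonneg.2 hb.le
  constructor
  · rcases lt_trichotomy x K with hxK | rfl | hxK
    · exact hAx.trans (lt_pbcMap hb (hf.lt_map x ⟨hx, hxK⟩)).le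
    · rwa [pbcMap_self b hf.map_eq]
    · calc min x₀ (β * K) ≤ β * K := min_le_right _ _
        _ ≤ b * x := mul_le_mul hβb hxK.le hf.pos.le (hβ.le.trans hβb)
        _ ≤ pbcMap f b x := le_add_of_nonneg_left (mul_nonneg hb' (hf.map_nonneg x hxK))
  · calc pbcMap f b x ≤ (1 - b) * max x₀ (f c) + b * max x₀ (f c) :=
          add_le_add
            (mul_le_mul_of_nonneg_left ((hf.map_le_critical hx.le).trans (le_max_right _ _)) hb')
            (mul_le_mul_of_nonneg_left hxB (hβ.le.trans hβb))
      _ = max x₀ (f c) := by ring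

theorem lt_pbcMap_of_le_pbcMap (hf : WeakSingerMap f c K) {b x y : ℝ} (hb₀ : 0 ≤ b) (hb₁ : b < 1)
    (hb : -deriv f K * (1 - b) < 1 + b) (hx : x ∈ Ioo 0 K) (hy : K < y)
    (hxy : y ≤ pbcMap f b x) : x < pbcMap f b y := by
  by_contra! hyx
  rw [pbcMap] at hxy hyx
  have hxz : f x ≤ f (max x c) := by
    rcases le_total x c with hxc | hxc
    · rw [max_eq_right hxc]
      exact hf.le_map_critical x ⟨hx.1.le, hxc⟩
    · rw [max_eq_left hxc]
  have hzK : max x c < K := max_lt hx.2 hf.critical_lt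
  have hcross := inv_neg_deriv_mul_le_inv_add_inv (convex_Ici c)
    (hf.continuousOn.mono (Ici_subset_Ici.2 hf.critical_nonneg))
    (by rw [interior_Ici]; exact hf.deriv_neg) (by rw [interior_Ici]; exact hf.convexOn)
    (by rw [interior_Ici]; exact hf.critical_lt)
    (le_max_right x c) (hf.critical_lt.trans hy).le hzK hy
  rw [hf.map_eq] at hcross
  refine hcross.not_gt (inv_add_inv_lt_of_exchange hb₀ hb₁
    (neg_pos.2 (hf.deriv_neg K hf.critical_lt)) hb (sub_pos.2 hzK) (sub_pos.2 hy) ?_ ?_)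
  · linarith [mul_le_mul_of_nonneg_left hxz (sub_nonneg.2 hb₁.le),
      mul_le_mul_of_nonneg_left (le_max_left x c) hb₀]
  · linarith [le_max_left x c]

theorem equilibrium_lt_of_pbcMap_le (hf : WeakSingerMap f c K) {b x : ℝ} (hb : b < 1) (hx₀ : 0 < x)
    (hx : pbcMap f b x ≤ x) (hxK : pbcMap f b x < K) : K < x := by
  by_contra! h
  rcases h.lt_or_eq with h | rfl
  · exact (lt_pbcMap hb (hf.lt_map x ⟨hx₀, h⟩)).not_ge hx
  · exact hxK.ne (pbcMap_self b hf.map_eq)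

theorem lt_equilibrium_of_le_pbcMap (hf : WeakSingerMap f c K) {b x : ℝ} (hb : b < 1)
    (hx : x ≤ pbcMap f b x) (hxK : K < pbcMap f b x) : x < K := by
  by_contra! h
  rcases h.lt_or_eq with h | rfl
  · exact (pbcMap_lt hb (hf.map_lt h)).not_ge hx
  · exact hxK.ne' (pbcMap_self b hf.map_eq)

/-- Preimages in the attractor of its minimum and maximum would be exchanged by the control of
intensity `b₁`. -/
theorem attractor_subset_singleton (hf : WeakSingerMap f c K) {A B b₁ b₂ : ℝ} (hA : 0 < A)
    (hb₁ : 0 ≤ b₁) (hb₂ : b₂ < 1) (hb : -deriv f K * (1 - b₁) < 1 + b₁)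
    (hinv : image2 (pbcMap f) (Icc b₁ b₂) (Icc A B) ⊆ Icc A B) :
    attractor (pbcMap f) (Icc b₁ b₂) (Icc A B) ⊆ {K} := by
  have hcont := continuousOn_uncurry_pbcMap (hf.continuousOn_Icc (B := B) hA.le) (Icc b₁ b₂)
  set J := attractor (pbcMap f) (Icc b₁ b₂) (Icc A B)
  intro y hy
  have hpos : ∀ t ∈ J, 0 < t := fun t ht => hA.trans_le (mem_iInter.1 ht 0).1
  have hJ : IsCompact J := isCompact_attractor isCompact_Icc isCompact_Icc hcont hinv
  have hpre : J ⊆ image2 (pbcMap f) (Icc b₁ b₂) J :=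
    attractor_subset_image2 isCompact_Icc isCompact_Icc hcont hinv
  obtain ⟨p, hpJ, hmin⟩ := hJ.exists_isLeast ⟨y, hy⟩
  obtain ⟨q, hqJ, hmax⟩ := hJ.exists_isGreatest ⟨y, hy⟩
  obtain ⟨b, hbI, s, hs, rfl⟩ := hpre hpJ
  obtain ⟨b', hbI', t, ht, rfl⟩ := hpre hqJ
  have hlt : pbcMap f b s < K → K < s := hf.equilibrium_lt_of_pbcMap_le
    (hbI.2.trans_lt hb₂) (hpos s hs) (hmin hs)
  have hgt : K < pbcMap f b' t → t < K := hf.lt_equilibrium_of_le_pbcMap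
    (hbI'.2.trans_lt hb₂) (hmax ht)
  have hexchange : ¬(t < K ∧ K < s) := by
    rintro ⟨htK, hsK⟩
    have hts : s ≤ pbcMap f b₁ t := (hmax hs).trans
      (pbcMap_le_pbcMap_of_le_map (hf.lt_map t ⟨hpos t ht, htK⟩).le hbI'.1)
    have hst : pbcMap f b₁ s ≤ t :=
      (pbcMap_le_pbcMap_of_map_le (hf.map_lt hsK).le hbI.1).trans (hmin ht)
    exact (hf.lt_pbcMap_of_le_pbcMap hb₁ (hbI.1.trans_lt (hbI.2.trans_lt hb₂)) hb
      ⟨hpos t ht, htK⟩ hsK hts).not_ge hst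
  have hKp : K ≤ pbcMap f b s := by
    by_contra! h
    exact hexchange ⟨hgt ((hlt h).trans_le (hmax hs)), hlt h⟩
  have hqK : pbcMap f b' t ≤ K := by
    by_contra! h
    exact hexchange ⟨hgt h, hlt ((hmin ht).trans_lt (hgt h))⟩
  exact le_antisymm ((hmax hy).trans hqK) (hKp.trans (hmin hy))

theorem exists_uniform_attraction (hf : WeakSingerMap f c K) {A B b₁ b₂ : ℝ} (hA : 0 < A)
    (hb₁ : 0 ≤ b₁) (hb₂ : b₂ < 1) (hb : -deriv f K * (1 - b₁) < 1 + b₁)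
    (hinv : image2 (pbcMap f) (Icc b₁ b₂) (Icc A B) ⊆ Icc A B) {V : Set ℝ} (hV : V ∈ 𝓝 K) :
    ∃ N, ∀ z : ℕ → ℝ, z 0 ∈ Icc A B →
      (∀ i < N, ∃ b ∈ Icc b₁ b₂, z (i + 1) = pbcMap f b (z i)) → z N ∈ V := by
  have hcont := continuousOn_uncurry_pbcMap (hf.continuousOn_Icc (B := B) hA.le) (Icc b₁ b₂)
  obtain ⟨N, hN⟩ := exists_reachableSet_subset isCompact_Icc isCompact_Icc hcont hinv
    (nhdsSet_mono (hf.attractor_subset_singleton hA hb₁ hb₂ hb hinv) (by rwa [nhdsSet_singleton]))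
  exact ⟨N, fun z hz₀ hz => hN (mem_reachableSet hz₀ hz)⟩

end WeakSingerMap

theorem tendsto_zero_of_le_exp_mul {d g : ℕ → ℝ} {δ C : ℝ} (hd : ∀ n, 0 ≤ d n)
    (hstep : ∀ n, d n < δ → d (n + 1) ≤ Real.exp (g n) * d n)
    (hC : ∀ n, ∑ i ∈ Finset.range n, g i ≤ C) (hd₀ : d 0 < δ * Real.exp (-C))
    (hlim : Tendsto (fun n => ∑ i ∈ Finset.range n, g i) atTop atBot) :
    Tendsto d atTop (𝓝 0) := by
  have hbound : ∀ n, d n ≤ Real.exp (∑ i ∈ Finset.range n, g i) * d 0 := by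
    intro n
    induction n with
    | zero => simp
    | succ n ih =>
      have hlt : d n < δ := calc
        d n ≤ Real.exp C * d 0 :=
          ih.trans (mul_le_mul_of_nonneg_right (Real.exp_le_exp.2 (hC n)) (hd 0))
        _ < Real.exp C * (δ * Real.exp (-C)) := mul_lt_mul_of_pos_left hd₀ (Real.exp_pos C)
        _ = δ := by rw [mul_left_comm, ← Real.exp_add, add_neg_cancel, Real.exp_zero, mul_one]
      calc d (n + 1) ≤ Real.exp (g n) * d n := hstep n hlt
        _ ≤ Real.exp (g n) * (Real.exp (∑ i ∈ Finset.range n, g i) * d 0) := by gcongr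
        _ = Real.exp (∑ i ∈ Finset.range (n + 1), g i) * d 0 := by
          rw [Finset.sum_range_succ, Real.exp_add]
          ring
  refine squeeze_zero hd hbound ?_
  simpa using (Real.tendsto_exp_atBot.comp hlim).mul_const (d 0)

theorem tendsto_atBot_sum_range_shift {g : ℕ → ℝ}
    (h : Tendsto (fun n => ∑ i ∈ Finset.range n, g i) atTop atBot) (k : ℕ) :
    Tendsto (fun n => ∑ i ∈ Finset.range n, g (k + i)) atTop atBot := by
  have hshift := (tendsto_add_atTop_iff_nat k).2 h
  refine (tendsto_atBot_add_const_right _ (-∑ i ∈ Finset.range k, g i) hshift).congr fun n => ?_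
  rw [add_comm n k, Finset.sum_range_add]
  ring

namespace WeakSingerMap

variable {f : ℝ → ℝ} {c K : ℝ}

/-- The block of intensities at least `b₁` brings the orbit so close to `K` that the bound `C` on
the growth of the later distances keeps it in the region where the local estimate applies. -/
theorem tendsto_of_forall_exists_block (hf : WeakSingerMap f c K) {β₁ β₂ b₁ C : ℝ}
    {b g z : ℕ → ℝ} (hβ₁ : 0 < β₁) (hβ₂ : β₂ < 1) (hb : ∀ n, b n ∈ Icc β₁ β₂) (hb₁ : β₁ ≤ b₁)
    (hstable : -deriv f K * (1 - b₁) < 1 + b₁)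
    (hlocal : ∀ᶠ x in 𝓝 K, ∀ n, |pbcMap f (b n) x - K| ≤ Real.exp (g n) * |x - K|)
    (hblock : ∀ N, ∃ k, (∀ i < N, b₁ ≤ b (k + i)) ∧
      ∀ n, ∑ i ∈ Finset.range n, g (k + N + i) ≤ C)
    (hlim : Tendsto (fun n => ∑ i ∈ Finset.range n, g i) atTop atBot)
    (hz₀ : 0 < z 0) (hz : ∀ n, z (n + 1) = pbcMap f (b n) (z n)) : Tendsto z atTop (𝓝 K) := by
  obtain ⟨A, B, hA, hz₀AB, hinv⟩ := hf.exists_invariant_Icc hβ₁ hz₀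
  have hzAB : ∀ n, z n ∈ Icc A B := by
    intro n
    induction n with
    | zero => exact hz₀AB
    | succ n ih => exact hz n ▸ hinv (b n) ⟨(hb n).1, (hb n).2.trans_lt hβ₂⟩ ih
  obtain ⟨δ, hδ, hball⟩ := Metric.eventually_nhds_iff.1 hlocal
  obtain ⟨N, hN⟩ := hf.exists_uniform_attraction hA (hβ₁.le.trans hb₁) hβ₂ hstable
    (image2_subset_iff.2 fun b hb x hx => hinv b ⟨hb₁.trans hb.1, hb.2.trans_lt hβ₂⟩ hx)
    (Metric.ball_mem_nhds K (mul_pos hδ (Real.exp_pos (-C))))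
  obtain ⟨k, hk, hC⟩ := hblock N
  have hclose : |z (k + N) - K| < δ * Real.exp (-C) :=
    hN (fun n => z (k + n)) (hzAB k) fun i hi =>
      ⟨b (k + i), ⟨hk i hi, (hb _).2⟩, hz (k + i)⟩
  have hdist : Tendsto (fun n => |z (k + N + n) - K|) atTop (𝓝 0) :=
    tendsto_zero_of_le_exp_mul (fun n => abs_nonneg _)
      (fun n hn => by
        rw [← add_assoc, hz]
        exact hball hn (k + N + n))
      hC hclose (tendsto_atBot_sum_range_shift hlim (k + N))
  rw [← tendsto_add_atTop_iff_nat (k + N), tendsto_iff_norm_sub_tendsto_zero]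
  simpa only [Real.norm_eq_abs, add_comm _ (k + N)] using hdist

end WeakSingerMap

section IID

theorem le_measure_limsup_atTop {Ω : Type*} [MeasurableSpace Ω] {μ : Measure Ω}
    [IsFiniteMeasure μ] {s : ℕ → Set Ω} {r : ENNReal} (hs : ∀ n, MeasurableSet (s n))
    (hr : ∀ n, r ≤ μ (s n)) : r ≤ μ (limsup s atTop) := by
  rw [limsup_eq_iInf_iSup_of_nat', iInf_eq_iInter, Antitone.measure_iInter]
  · exact le_iInf fun n => (hr n).trans (measure_mono (by
      simpa using le_iSup (fun i => s (i + n)) 0))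
  · refine fun n m hnm => iSup_le fun i => ?_
    have h := le_iSup (fun j => s (j + n)) (i + (m - n))
    rwa [add_assoc, Nat.sub_add_cancel hnm] at h
  · exact fun n => (MeasurableSet.iUnion fun i => hs _).nullMeasurableSet
  · exact ⟨0, measure_ne_top _ _⟩

variable {Ω E : Type*} [MeasurableSpace E] {X : ℕ → Ω → E}

theorem measurable_shift_iSup_comap {S : Set ℕ} {k : ℕ} (hk : ∀ i, k + i ∈ S) :
    Measurable[⨆ i ∈ S, MeasurableSpace.comap (X i) inferInstance] fun ω i => X (k + i) ω :=
  @measurable_pi_lambda _ _ _ (_) _ _ fun i => (comap_measurable (X (k + i))).mono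
    (le_iSup₂ (f := fun j (_ : j ∈ S) => MeasurableSpace.comap (X j) inferInstance) (k + i) (hk i))
    le_rfl

variable [MeasurableSpace Ω] {P : Measure Ω} {g : E → ℝ}

theorem identDistrib_shift (hind : iIndepFun X P) (hid : ∀ n, IdentDistrib (X n) (X 0) P P)
    (k : ℕ) : IdentDistrib (fun ω i => X (k + i) ω) (fun ω i => X i ω) P P :=
  IdentDistrib.pi (X := fun i => X (k + i)) (Y := X) (fun i => (hid (k + i)).trans (hid i).symm)
    (hind.precomp (add_right_injective k)) hind

theorem ae_tendsto_sum_atBot_of_integral_neg (hind : iIndepFun X P)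
    (hid : ∀ n, IdentDistrib (X n) (X 0) P P) (hg : Measurable g)
    (hint : Integrable (fun ω => g (X 0 ω)) P) (hneg : ∫ ω, g (X 0 ω) ∂P < 0) :
    ∀ᵐ ω ∂P, Tendsto (fun n => ∑ i ∈ Finset.range n, g (X i ω)) atTop atBot := by
  filter_upwards [strong_law_ae_real (fun n ω => g (X n ω)) hint
    (fun i j hij => (hind.indepFun hij).comp hg hg) fun i => (hid i).comp hg] with ω hω
  refine (hω.neg_mul_atTop hneg tendsto_natCast_atTop_atTop).congr' ?_
  filter_upwards [eventually_gt_atTop 0] with n hn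
  exact div_mul_cancel₀ _ (Nat.cast_ne_zero.2 hn.ne')

theorem measurableSet_setOf_forall_sum_le (hg : Measurable g) (C : ℝ) :
    MeasurableSet {z : ℕ → E | ∀ n, ∑ i ∈ Finset.range n, g (z i) ≤ C} := by
  simp only [ofPred_forall]
  exact MeasurableSet.iInter fun n => measurableSet_le
    (Finset.measurable_fun_sum _ fun i _ => hg.comp (measurable_pi_apply i)) measurable_const

theorem measure_forall_lt_mem_inter_shift_mem (hm : ∀ n, Measurable (X n)) (hind : iIndepFun X P)
    (hid : ∀ n, IdentDistrib (X n) (X 0) P P) {S : Set E} (hS : MeasurableSet S)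
    {D : Set (ℕ → E)} (hD : MeasurableSet D) (N : ℕ) :
    P {ω | (∀ i < N, X i ω ∈ S) ∧ (fun i => X (N + i) ω) ∈ D} =
      P {ω | X 0 ω ∈ S} ^ N * P {ω | (fun i => X i ω) ∈ D} := by
  have hpast : MeasurableSet[⨆ i ∈ Iio N, MeasurableSpace.comap (X i) inferInstance]
      (⋂ i ∈ Finset.range N, X i ⁻¹' S) :=
    Finset.measurableSet_biInter _ fun i hi =>
      le_iSup₂ (f := fun j (_ : j ∈ Iio N) => MeasurableSpace.comap (X j) inferInstance) i
        (Finset.mem_range.1 hi) _ ⟨S, hS, rfl⟩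
  have hfuture : MeasurableSet[⨆ i ∈ Ici N, MeasurableSpace.comap (X i) inferInstance]
      ((fun ω i => X (N + i) ω) ⁻¹' D) :=
    measurable_shift_iSup_comap (fun i => mem_Ici.2 (Nat.le_add_right N i)) hD
  have hindep := indep_iSup_of_disjoint (fun n => (hm n).comap_le) hind
    (Set.Iio_disjoint_Ici le_rfl : Disjoint (Iio N) (Ici N))
  have hsplit : {ω | (∀ i < N, X i ω ∈ S) ∧ (fun i => X (N + i) ω) ∈ D} =
      (⋂ i ∈ Finset.range N, X i ⁻¹' S) ∩ (fun ω i => X (N + i) ω) ⁻¹' D := by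
    ext ω
    simp
  rw [hsplit, (Indep_iff _ _ _).1 hindep _ _ hpast hfuture,
    hind.measure_inter_preimage_eq_mul _ fun _ _ => hS,
    Finset.prod_congr rfl fun i _ => (hid i).measure_mem_eq hS, Finset.prod_const,
    Finset.card_range]
  exact congrArg _ ((identDistrib_shift hind hid N).measure_mem_eq hD)

variable [IsProbabilityMeasure P]

theorem ae_frequently_shift_mem (hm : ∀ n, Measurable (X n)) (hind : iIndepFun X P)
    (hid : ∀ n, IdentDistrib (X n) (X 0) P P) {A : Set (ℕ → E)} (hA : MeasurableSet A)
    (hpos : P {ω | (fun i => X i ω) ∈ A} ≠ 0) :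
    ∀ᵐ ω ∂P, ∃ᶠ k in atTop, (fun i => X (k + i) ω) ∈ A := by
  let occurs : ℕ → Set Ω := fun k => (fun ω i => X (k + i) ω) ⁻¹' A
  have hmeas : ∀ k, MeasurableSet (occurs k) := fun k =>
    (measurable_pi_lambda _ fun i => hm (k + i)) hA
  have hprob : ∀ k, P {ω | (fun i => X i ω) ∈ A} ≤ P (occurs k) := fun k =>
    ((identDistrib_shift hind hid k).measure_mem_eq hA).ge
  have htail : MeasurableSet[limsup (fun i => MeasurableSpace.comap (X i) inferInstance) atTop]
      (limsup occurs atTop) := by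
    rw [limsup_eq_iInf_iSup_of_nat, MeasurableSpace.measurableSet_iInf]
    intro n
    rw [← limsup_nat_add occurs n]
    exact @MeasurableSet.measurableSet_limsup _ (_) _ fun k =>
      measurable_shift_iSup_comap (S := {i | i ≥ n})
        (fun i => (Nat.le_add_left n k).trans (Nat.le_add_right _ i)) hA
  have hone : P (limsup occurs atTop) = 1 :=
    (measure_zero_or_one_of_measurableSet_limsup_atTop (fun n => (hm n).comap_le) hind
      htail).resolve_left (((pos_iff_ne_zero.2 hpos).trans_le
        (le_measure_limsup_atTop hmeas hprob)).ne')
  filter_upwards [(prob_compl_eq_zero_iff (MeasurableSet.measurableSet_limsup hmeas)).2 hone]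
    with ω hω using mem_limsup_iff_frequently_mem.1 hω

theorem exists_measure_forall_sum_le_ne_zero (hind : iIndepFun X P)
    (hid : ∀ n, IdentDistrib (X n) (X 0) P P) (hg : Measurable g)
    (hint : Integrable (fun ω => g (X 0 ω)) P) (hneg : ∫ ω, g (X 0 ω) ∂P < 0) :
    ∃ C : ℝ, P {ω | ∀ n, ∑ i ∈ Finset.range n, g (X i ω) ≤ C} ≠ 0 := by
  by_contra! hzero
  have hunbounded : ∀ᵐ ω ∂P, ∀ C : ℕ, ¬∀ n, ∑ i ∈ Finset.range n, g (X i ω) ≤ C :=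
    ae_all_iff.2 fun C => measure_eq_zero_iff_ae_notMem.1 (hzero C)
  obtain ⟨ω, hω, hlim⟩ :=
    (hunbounded.and (ae_tendsto_sum_atBot_of_integral_neg hind hid hg hint hneg)).exists
  obtain ⟨M, hM⟩ := hlim.isBoundedUnder_le_atBot.bddAbove_range
  obtain ⟨C, hC⟩ := exists_nat_ge M
  exact hω C fun n => (hM (mem_range_self n)).trans hC

theorem exists_ae_exists_block (hm : ∀ n, Measurable (X n)) (hind : iIndepFun X P)
    (hid : ∀ n, IdentDistrib (X n) (X 0) P P) (hg : Measurable g)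
    (hint : Integrable (fun ω => g (X 0 ω)) P) (hneg : ∫ ω, g (X 0 ω) ∂P < 0) :
    ∃ C : ℝ, ∀ S, MeasurableSet S → P {ω | X 0 ω ∈ S} ≠ 0 → ∀ N, ∀ᵐ ω ∂P, ∃ k,
      (∀ i < N, X (k + i) ω ∈ S) ∧ ∀ n, ∑ i ∈ Finset.range n, g (X (k + N + i) ω) ≤ C := by
  obtain ⟨C, hC⟩ := exists_measure_forall_sum_le_ne_zero hind hid hg hint hneg
  have hD := measurableSet_setOf_forall_sum_le hg C
  refine ⟨C, fun S hS hpos N => ?_⟩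
  have hA : MeasurableSet {z : ℕ → E | (∀ i < N, z i ∈ S) ∧
      (fun i => z (N + i)) ∈ {z : ℕ → E | ∀ n, ∑ i ∈ Finset.range n, g (z i) ≤ C}} := by
    have hshift : Measurable fun (z : ℕ → E) i => z (N + i) :=
      measurable_pi_lambda _ fun i => measurable_pi_apply (N + i)
    have hblock : MeasurableSet {z : ℕ → E | ∀ i < N, z i ∈ S} := by
      simp only [ofPred_forall]
      exact MeasurableSet.iInter fun i => MeasurableSet.iInter fun _ => measurable_pi_apply i hS
    exact hblock.inter (hshift hD)
  have hAne := (measure_forall_lt_mem_inter_shift_mem hm hind hid hS hD N).trans_ne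
    (mul_ne_zero (pow_ne_zero N hpos) hC)
  filter_upwards [ae_frequently_shift_mem hm hind hid hA hAne] with ω hω
  obtain ⟨k, hblock, hsum⟩ := hω.exists
  exact ⟨k, hblock, fun n => by simpa only [add_assoc] using hsum n⟩

end IID

theorem exists_pos_forall_exp_add_le {T : Type*} [TopologicalSpace T] {G : T → ℝ} {s : Set T}
    (hs : IsCompact s) (hG : ContinuousOn G s) {κ : ℝ} (hκ : 0 < κ) :
    ∃ ε > 0, ∀ t ∈ s, Real.exp (G t) + ε ≤ Real.exp (G t + κ) := by
  obtain ⟨M, hM⟩ := hs.exists_bound_of_continuousOn hG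
  have hpos : 0 < Real.exp κ - 1 := sub_pos.2 (Real.one_lt_exp_iff.2 hκ)
  refine ⟨Real.exp (-M) * (Real.exp κ - 1), mul_pos (Real.exp_pos _) hpos, fun t ht => ?_⟩
  have hle : Real.exp (-M) ≤ Real.exp (G t) := Real.exp_le_exp.2 (abs_le.1 (hM t ht)).1
  rw [Real.exp_add]
  linarith [mul_le_mul_of_nonneg_right hle hpos.le]

theorem mul_one_sub_lt_one_add_iff {L b : ℝ} (hL : 0 < L) :
    L * (1 - b) < 1 + b ↔ (L - 1) / (L + 1) < b := by
  rw [div_lt_iff₀ (by positivity)]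
  constructor <;> intro h <;> linarith

theorem abs_multiplier_le_exp_log {b L : ℝ} (h : 0 < (1 - b) * L - b) :
    |b + (1 - b) * -L| ≤ Real.exp (Real.log ((1 - b) * L - b)) := by
  rw [Real.exp_log h, ← abs_neg, abs_of_pos] <;> linarith

theorem abs_multiplier_le_exp_max_log {b L : ℝ} (hL : 0 < L) (hb : b ∈ Ioo 0 1) :
    |b + (1 - b) * -L| ≤ Real.exp (max (Real.log ((1 - b) * L)) (Real.log b)) := by
  have hbL : 0 < (1 - b) * L := mul_pos (sub_pos.2 hb.2) hL
  rw [Real.exp_monotone.map_max, Real.exp_log hbL, Real.exp_log hb.1, abs_le]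
  constructor
  · linarith [le_max_left ((1 - b) * L) b, hb.1]
  · linarith [le_max_right ((1 - b) * L) b]

theorem WeakSingerMap.eventually_abs_pbcMap_sub_le_exp {f : ℝ → ℝ} {c K β₁ β₂ κ : ℝ}
    (hf : WeakSingerMap f c K) (hβ₁ : 0 ≤ β₁) (hβ₂ : β₂ ≤ 1) {G : ℝ → ℝ}
    (hG : ContinuousOn G (Icc β₁ β₂))
    (hdom : ∀ b ∈ Icc β₁ β₂, |b + (1 - b) * deriv f K| ≤ Real.exp (G b)) (hκ : 0 < κ) :
    ∀ᶠ x in 𝓝 K, ∀ b ∈ Icc β₁ β₂, |pbcMap f b x - K| ≤ Real.exp (G b + κ) * |x - K| := by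
  obtain ⟨ε, hε, hexp⟩ := exists_pos_forall_exp_add_le isCompact_Icc hG hκ
  have hd : DifferentiableAt ℝ f K :=
    differentiableAt_of_deriv_ne_zero (hf.deriv_neg K hf.critical_lt).ne
  filter_upwards [eventually_abs_pbcMap_sub_le hd hf.map_eq hε] with x hx b hb
  calc |pbcMap f b x - K|
      ≤ (|b + (1 - b) * deriv f K| + ε) * |x - K| := hx b ⟨hβ₁.trans hb.1, hb.2.trans hβ₂⟩
    _ ≤ Real.exp (G b + κ) * |x - K| := by
        gcongr
        linarith [hdom b hb, hexp b hb]

theorem intensity_mem_Icc {α ℓ t : ℝ} (hℓ : 0 ≤ ℓ) (ht : t ∈ Icc (-1 : ℝ) 1) :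
    α + ℓ * t ∈ Icc (α - ℓ) (α + ℓ) := by
  have h₁ := mul_le_mul_of_nonneg_left ht.1 hℓ
  have h₂ := mul_le_mul_of_nonneg_left ht.2 hℓ
  constructor <;> linarith

section Stabilization

variable {Ω : Type*} [MeasurableSpace Ω] {P : Measure Ω} [IsProbabilityMeasure P]
  {ξ : ℕ → Ω → ℝ} {f : ℝ → ℝ} {c K α ℓ : ℝ}

theorem BoundedNoise.integrable_intensity (hξ : BoundedNoise P ξ) (hℓ : 0 ≤ ℓ) {G : ℝ → ℝ}
    (hG : Measurable G) (hGc : ContinuousOn G (Icc (α - ℓ) (α + ℓ))) :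
    Integrable (fun ω => G (α + ℓ * ξ 0 ω)) P := by
  obtain ⟨M, hM⟩ := isCompact_Icc.exists_bound_of_continuousOn hGc
  have hmeas : Measurable fun t => G (α + ℓ * t) := by fun_prop
  refine Integrable.of_bound (hmeas.comp (hξ.measurable 0)).aestronglyMeasurable M ?_
  filter_upwards [hξ.bounded 0] with ω hω using hM _ (intensity_mem_Icc hℓ (abs_le.1 hω))

theorem WeakSingerMap.ae_tendsto_of_integral_neg (hf : WeakSingerMap f c K)
    (hξ : BoundedNoise P ξ) (hℓ : 0 < ℓ) (hℓα : ℓ < α) (hαℓ : α + ℓ < 1)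
    (hstable : -deriv f K * (1 - (α + ℓ)) < 1 + (α + ℓ)) {G : ℝ → ℝ} (hG : Measurable G)
    (hGc : ContinuousOn G (Icc (α - ℓ) (α + ℓ)))
    (hdom : ∀ b ∈ Icc (α - ℓ) (α + ℓ), |b + (1 - b) * deriv f K| ≤ Real.exp (G b))
    (hneg : ∫ ω, G (α + ℓ * ξ 0 ω) ∂P < 0) :
    ∀ᵐ ω ∂P, ∀ x : ℕ → ℝ, 0 < x 0 → (∀ n, x (n + 1) = pbcMap f (α + ℓ * ξ n ω) (x n)) →
      Tendsto x atTop (𝓝 K) := by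
  obtain ⟨κ, hκ, hκG⟩ : ∃ κ > 0, κ < -∫ ω, G (α + ℓ * ξ 0 ω) ∂P :=
    exists_between (neg_pos.2 hneg)
  have hmeas : Measurable fun t => G (α + ℓ * t) + κ := by fun_prop
  have hint := hξ.integrable_intensity hℓ.le hG hGc
  have hintκ : Integrable (fun ω => G (α + ℓ * ξ 0 ω) + κ) P := hint.add (integrable_const κ)
  have hnegκ : ∫ ω, (G (α + ℓ * ξ 0 ω) + κ) ∂P < 0 := by
    rw [integral_add hint (integrable_const κ), integral_const, probReal_univ, one_smul]
    linarith
  have hL := neg_pos.2 (hf.deriv_neg K hf.critical_lt)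
  rw [mul_one_sub_lt_one_add_iff hL] at hstable
  obtain ⟨b₁, hb₁, hb₁α⟩ := exists_between (max_lt (show α - ℓ < α + ℓ by linarith) hstable)
  obtain ⟨hαb₁, hstable₁⟩ := max_lt_iff.1 hb₁
  obtain ⟨C, hC⟩ :=
    exists_ae_exists_block hξ.measurable hξ.indep hξ.identDistrib hmeas hintκ hnegκ
  have hcharge := (hξ.charges_one _ (div_pos (sub_pos.2 hb₁α) hℓ) 0).ne'
  have hlocal := hf.eventually_abs_pbcMap_sub_le_exp (sub_nonneg.2 hℓα.le) hαℓ.le hGc hdom hκ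
  filter_upwards [ae_all_iff.2 hξ.bounded, ae_all_iff.2 (hC _ measurableSet_Ioc hcharge),
    ae_tendsto_sum_atBot_of_integral_neg hξ.indep hξ.identDistrib hmeas hintκ hnegκ]
    with ω hω hblock hlim x hx₀ hx
  have hmem : ∀ n, α + ℓ * ξ n ω ∈ Icc (α - ℓ) (α + ℓ) := fun n =>
    intensity_mem_Icc hℓ.le (abs_le.1 (hω n))
  refine hf.tendsto_of_forall_exists_block (C := C) (sub_pos.2 hℓα) hαℓ hmem hαb₁.le
    ((mul_one_sub_lt_one_add_iff hL).2 hstable₁) (hlocal.mono fun y hy n => hy _ (hmem n))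
    (fun N => ?_) hlim hx₀ hx
  obtain ⟨k, hk, hsum⟩ := hblock N
  refine ⟨k, fun i hi => ?_, hsum⟩
  have h := (hk i hi).1
  rw [sub_lt_comm, lt_div_iff₀' hℓ] at h
  linarith

end Stabilization

theorem mainTheorem2_general {Ω : Type*} [MeasurableSpace Ω] (P : Measure Ω)
    [IsProbabilityMeasure P] (ξ : ℕ → Ω → ℝ) (hξ : BoundedNoise P ξ)
    (f : ℝ → ℝ) (c K : ℝ) (hf : WeakSingerMap f c K)
    (L₀ α₀ : ℝ) (hL₀ : L₀ = -deriv f K) (hα₀ : α₀ = (L₀ - 1) / (L₀ + 1))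
    (α ℓ : ℝ) (hℓ : ℓ ∈ Ioo 0 (min α (1 - α))) (hαℓ : α₀ < α + ℓ)
    (hcond :
      (α + ℓ < L₀ / (L₀ + 1) ∧
        ∫ ω, Real.log ((1 - α - ℓ * ξ 0 ω) * L₀ - α - ℓ * ξ 0 ω) ∂P < 0) ∨
      ∫ ω, max (Real.log ((1 - α - ℓ * ξ 0 ω) * L₀)) (Real.log (α + ℓ * ξ 0 ω)) ∂P < 0) :
    ∀ᵐ ω ∂P, ∀ x : ℕ → ℝ, 0 < x 0 →
      (∀ n, x (n + 1) = (1 - α - ℓ * ξ n ω) * f (x n) + (α + ℓ * ξ n ω) * x n) →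
      Tendsto x atTop (𝓝 K) := by
  have hL : 0 < L₀ := hL₀ ▸ neg_pos.2 (hf.deriv_neg K hf.critical_lt)
  have hderiv : deriv f K = -L₀ := by rw [hL₀, neg_neg]
  obtain ⟨hℓα, hℓα'⟩ := lt_min_iff.1 hℓ.2
  have hαℓ₁ : α + ℓ < 1 := by linarith
  have hstable := (mul_one_sub_lt_one_add_iff hL).2 (hα₀ ▸ hαℓ)
  have hb : ∀ b ∈ Icc (α - ℓ) (α + ℓ), b ∈ Ioo 0 1 := fun b hb =>
    ⟨(sub_pos.2 hℓα).trans_le hb.1, hb.2.trans_lt hαℓ₁⟩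
  simp only [sub_sub _ α] at hcond ⊢
  rcases hcond with ⟨hαL, hneg⟩ | hneg
  · rw [lt_div_iff₀ (by positivity)] at hαL
    have hpos : ∀ b ∈ Icc (α - ℓ) (α + ℓ), 0 < (1 - b) * L₀ - b := fun b hb => by
      linarith [mul_le_mul_of_nonneg_right hb.2 (add_pos hL one_pos).le]
    refine hf.ae_tendsto_of_integral_neg (G := fun b => Real.log ((1 - b) * L₀ - b)) hξ hℓ.1 hℓα
      hαℓ₁ (hL₀ ▸ hstable) (by fun_prop) ?_ (fun b hb => ?_) hneg
    · exact ContinuousOn.log (by fun_prop) fun b hb => (hpos b hb).ne'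
    · exact hderiv ▸ abs_multiplier_le_exp_log (hpos b hb)
  · refine hf.ae_tendsto_of_integral_neg
      (G := fun b => max (Real.log ((1 - b) * L₀)) (Real.log b)) hξ hℓ.1 hℓα
      hαℓ₁ (hL₀ ▸ hstable) (by fun_prop) ?_ (fun b h => ?_) hneg
    · exact (ContinuousOn.log (by fun_prop) fun b h =>
        (mul_pos (sub_pos.2 (hb b h).2) hL).ne').sup
          (continuousOn_id.log fun b h => (hb b h).1.ne')
    · exact hderiv ▸ abs_multiplier_le_exp_max_log hL (hb b h)

theorem mainTheorem2 {Ω : Type*} [MeasurableSpace Ω] (P : Measure Ω) [IsProbabilityMeasure P]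
    (ξ : ℕ → Ω → ℝ) (hξ : BoundedNoise P ξ)
    (f : ℝ → ℝ) (K : ℝ) (hf : SingerMap f K)
    (L₀ α₀ : ℝ) (hL₀ : L₀ = -deriv f K) (hα₀ : α₀ = (L₀ - 1) / (L₀ + 1))
    (α ℓ : ℝ) (hα : α ∈ Ioo 0 α₀) (hℓ : ℓ ∈ Ioo (α₀ - α) (min α (1 - α)))
    (hcond :
      (α + ℓ < L₀ / (L₀ + 1) ∧
        ∫ ω, Real.log ((1 - α - ℓ * ξ 0 ω) * L₀ - α - ℓ * ξ 0 ω) ∂P < 0) ∨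
      ∫ ω, max (Real.log ((1 - α - ℓ * ξ 0 ω) * L₀)) (Real.log (α + ℓ * ξ 0 ω)) ∂P < 0)
    (x₀ : ℝ) (hx₀ : 0 < x₀) (x : ℕ → Ω → ℝ) (hx : IsPBCSolution f α ℓ ξ x₀ x) :
    ∀ᵐ ω ∂P, Tendsto (fun n => x n ω) atTop (𝓝 K) := by
  obtain ⟨c, hfc⟩ := hf.exists_weakSingerMap
  filter_upwards [mainTheorem2_general P ξ hξ f c K hfc L₀ α₀ hL₀ hα₀ α ℓ
    ⟨(sub_pos.2 hα.2).trans hℓ.1, hℓ.2⟩ (sub_lt_iff_lt_add'.1 hℓ.1) hcond] with ω h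
  exact h _ (hx.1 ω ▸ hx₀) fun n => hx.2 n ω
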